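/- Let $\mathbb X,\mathbb U,\mathcal M$ be finite non-empty sets (states, control actions, channel symbols), let $c:\mathbb X\times\mathbb U\to\mathbb R$ be a cost function and let $\beta\in(0,1)$. Consider the controlled Markov source $$x_{t+1}=f(x_t,u_t,w_t),\qquad t\ge 0,$$ where $w_0,w_1,\dots$ are i.i.d. random variables in a measurable space $\mathbb W$, $f(x,u,\cdot)$ is measurable for all $(x,u)$, and $x_0$ has law $\pi_0\in\mathcal P(\mathbb X)$ and is independent of $(w_t)_{t\ge0}$. An admissible joint coding–control policy $\bar\gamma\in\Gamma_A$ is a sequence of maps $(\gamma^e_t,\gamma^c_t)_{t\ge 0}$ generating $q_t=\gamma^e_t(x_{[0,t]},q_{[0,t-1]})\in\mathcal M$ and $u_t=\gamma^c_t(q_{[0,t]},u_{[0,t-1]})\in\mathbb U$. Its discounted cost is $$J_\beta(\pi_0,\bar\gamma)=\lim_{N\to\infty}E^{\bar\gamma}_{\pi_0}\Big[\sum_{k=0}^{N-1}\beta^k c(x_k,u_k)\Big].$$ Let $\pi_t(\cdot)=P^{\bar\gamma}_{\pi_0}(x_t=\cdot\mid q_{[0,t-1]})\in\mathcal P(\mathbb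 X)$ be the predictor (set to $\pi_0$ on realizations of $q_{[0,t-1]}$ of probability zero), let $\mathcal Q$ be the set of quantizers $Q:\mathbb X\to\mathcal M$ and $\mathcal H$ the set of maps $\eta:\mathcal Q\times\mathcal M\to\mathbb U$. A policy belongs to $\Gamma_{C\text{-}P}$ (controlled-predictor structure) if there are measurable maps $g_t:\mathcal P(\mathbb X)\to\mathcal Q\times\mathcal H$ such that, with $(Q_t,\eta_t)=g_t(\pi_t)$, it generates $q_t=Q_t(x_t)$ and $u_t=\eta_t(Q_t,q_t)$ for all $t\ge0$; it is stationary if $g_t=g$ does not depend on $t$. Theorem. The limit defining $J_\beta(\pi_0,\bar\gamma)$ exists for all $\pi_0$ and all $\bar\gamma\in\Gamma_A$, and there is a measurable map $g:\mathcal P(\mathbb X)\to\mathcal Q\times\mathcal H$ such that for every initial law $\pi_0$ the stationary policy $\bar\gamma^*\in\Gamma_{C\text{-}P}$ given by $g$ is optimal among all admissible policies: $$J_\beta(\pi_0,\bar\gamma^*)=\min_{\bar\gamma\in\Gamma_A}J_\beta(\pi_0,\bar\gamma).$$ Moreover, with $\tilde c(\pi,Q,\eta)=\sum_{x\in\mathbb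 X}\pi(x)\,c\big(x,\eta(Q,Q(x))\big)$, this optimal cost equals $\lim_{N\to\infty}E^{\bar\gamma^*}_{\pi_0}\big[\sum_{k=0}^{N-1}\beta^k\tilde c(\pi_k,Q_k,\eta_k)\big]$. -/

import Mathlib

open MeasureTheory ProbabilityTheory Filter Topology

noncomputable section

namespace CodingControl

/-- The controlled Markov source `x_{t+1} = f(x_t, u_t, w_t)`, where the noise variables `w_t`
are i.i.d. with law `noise`. -/
structure Plant (X U W : Type*) [MeasurableSpace X] [MeasurableSpace W] where
  f : X → U → W → X
  measurable_f : ∀ x u, Measurable (f x u)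
  noise : Measure W
  isProbabilityMeasure_noise : IsProbabilityMeasure noise

/-- An admissible joint coding-control policy: at time `t` the encoder computes
`q_t` from `(x_{[0,t]}, q_{[0,t-1]})`, and the controller computes
`u_t` from `(q_{[0,t]}, u_{[0,t-1]})`. The type `Policy X M U` is the class `Γ_A`. -/
structure Policy (X M U : Type*) where
  enc : (t : ℕ) → (Fin (t + 1) → X) → (Fin t → M) → M
  ctrl : (t : ℕ) → (Fin (t + 1) → M) → (Fin t → U) → U

/-- The finite set `𝒬` of quantizers. -/
abbrev Quantizer (X M : Type*) := X → M

/-- The finite set `ℋ` of control maps `η : (Q, q) ↦ u`. -/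
abbrev ControlMap (X M U : Type*) := Quantizer X M × M → U

section

variable {X M U W : Type*} [MeasurableSpace X] [MeasurableSpace W]

/-- The probability space carrying `x₀ ∼ π₀` and, independently of it, the i.i.d. noise
`w₀, w₁, …`. -/
def Plant.prob (S : Plant X U W) (π₀ : ProbabilityMeasure X) : Measure (X × (ℕ → W)) :=
  haveI := S.isProbabilityMeasure_noise
  (π₀ : Measure X).prod (Measure.infinitePi fun _ : ℕ => S.noise)

instance (S : Plant X U W) (π₀ : ProbabilityMeasure X) : IsProbabilityMeasure (S.prob π₀) := by
  haveI := S.isProbabilityMeasure_noise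
  unfold Plant.prob
  infer_instance

/-- One step of the closed loop, on histories `(x_{[0,t]}, q_{[0,t-1]}, u_{[0,t-1]})`. -/
def Plant.step (S : Plant X U W) (γ : Policy X M U) (t : ℕ)
    (h : (Fin (t + 1) → X) × (Fin t → M) × (Fin t → U)) (w : W) :
    (Fin (t + 2) → X) × (Fin (t + 1) → M) × (Fin (t + 1) → U) :=
  let q : Fin (t + 1) → M := Fin.snoc h.2.1 (γ.enc t h.1 h.2.1)
  let u : U := γ.ctrl t q h.2.2
  (Fin.snoc h.1 (S.f (h.1 (Fin.last t)) u w), q, Fin.snoc h.2.2 u)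

/-- The closed-loop history `(x_{[0,t]}, q_{[0,t-1]}, u_{[0,t-1]})` under the policy `γ`. -/
def Plant.hist (S : Plant X U W) (γ : Policy X M U) (ω : X × (ℕ → W)) :
    (t : ℕ) → (Fin (t + 1) → X) × (Fin t → M) × (Fin t → U)
  | 0 => (fun _ => ω.1, Fin.elim0, Fin.elim0)
  | t + 1 => S.step γ t (S.hist γ ω t) (ω.2 t)

/-- The state `x_t`. -/
def Plant.state (S : Plant X U W) (γ : Policy X M U) (t : ℕ) (ω : X × (ℕ → W)) : X :=
  (S.hist γ ω t).1 (Fin.last t)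

/-- The past channel symbols `q_{[0,t-1]}`. -/
def Plant.pastSymbols (S : Plant X U W) (γ : Policy X M U) (t : ℕ) (ω : X × (ℕ → W)) :
    Fin t → M :=
  (S.hist γ ω t).2.1

/-- The control action `u_t`. -/
def Plant.action (S : Plant X U W) (γ : Policy X M U) (t : ℕ) (ω : X × (ℕ → W)) : U :=
  (S.hist γ ω (t + 1)).2.2 (Fin.last t)

theorem Plant.measurable_state [Finite X] [DiscreteMeasurableSpace X] [Finite M] [Finite U]
    (S : Plant X U W) (γ : Policy X M U) (t : ℕ) : Measurable (S.state γ t) := by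
  have key : ∀ t, ∀ h, MeasurableSet {ω | S.hist γ ω t = h} := by
    intro t
    induction t with
    | zero =>
      intro h
      have : {ω : X × (ℕ → W) | S.hist γ ω 0 = h}
          = Prod.fst ⁻¹' {x : X | ((fun _ => x, Fin.elim0, Fin.elim0) :
              (Fin 1 → X) × (Fin 0 → M) × (Fin 0 → U)) = h} := rfl
      rw [this]
      exact measurable_fst (MeasurableSet.of_discrete)
    | succ t ih =>
      intro h
      have : {ω : X × (ℕ → W) | S.hist γ ω (t + 1) = h}
          = ⋃ h', ({ω | S.hist γ ω t = h'} ∩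
              (fun ω => ω.2 t) ⁻¹' {w | S.step γ t h' w = h}) := by
        ext ω
        simp [Plant.hist]
      rw [this]
      refine MeasurableSet.iUnion fun h' => (ih h').inter ?_
      refine ((measurable_pi_apply t).comp measurable_snd) ?_
      have hs : {w | S.step γ t h' w = h}
          = S.f (h'.1 (Fin.last t)) (γ.ctrl t (Fin.snoc h'.2.1 (γ.enc t h'.1 h'.2.1)) h'.2.2) ⁻¹'
            {x | ((Fin.snoc h'.1 x, Fin.snoc h'.2.1 (γ.enc t h'.1 h'.2.1),
              Fin.snoc h'.2.2 (γ.ctrl t (Fin.snoc h'.2.1 (γ.enc t h'.1 h'.2.1)) h'.2.2)) :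
              (Fin (t + 2) → X) × (Fin (t + 1) → M) × (Fin (t + 1) → U)) = h} := rfl
      rw [hs]
      exact S.measurable_f _ _ MeasurableSet.of_discrete
  intro s _
  have : S.state γ t ⁻¹' s
      = ⋃ h : {h : (Fin (t + 1) → X) × (Fin t → M) × (Fin t → U) // h.1 (Fin.last t) ∈ s},
          {ω | S.hist γ ω t = h.1} := by
    ext ω
    simp [Plant.state]
  rw [this]
  exact MeasurableSet.iUnion fun h => key t h.1

open Classical in
/-- The predictor `π_t = P^γ(x_t = · | q_{[0,t-1]})` at the realization `q` of `q_{[0,t-1]}`.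
On realizations of probability zero, where the conditional law is undefined, it is set
to `π₀`. -/
def Plant.predictor [Finite X] [DiscreteMeasurableSpace X] [Finite M] [Finite U]
    (S : Plant X U W) (π₀ : ProbabilityMeasure X) (γ : Policy X M U) (t : ℕ) (q : Fin t → M) :
    ProbabilityMeasure X :=
  if hq : S.prob π₀ {ω | S.pastSymbols γ t ω = q} ≠ 0 then
    ⟨(cond (S.prob π₀) {ω | S.pastSymbols γ t ω = q}).map (S.state γ t), by
      haveI := cond_isProbabilityMeasure hq
      exact Measure.isProbabilityMeasure_map (S.measurable_state γ t).aemeasurable⟩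
  else π₀

/-- The policy `γ` has the controlled-predictor structure given by the maps
`g t : π_t ↦ (Q_t, η_t)`: it generates `q_t = Q_t(x_t)` and `u_t = η_t(Q_t, q_t)`, where `π_t`
is the predictor under `γ` itself, started from `π₀`. -/
def Plant.HasControlledPredictorStructure [Finite X] [DiscreteMeasurableSpace X]
    [Finite M] [Finite U] (S : Plant X U W) (π₀ : ProbabilityMeasure X) (γ : Policy X M U)
    (g : ℕ → ProbabilityMeasure X → Quantizer X M × ControlMap X M U) : Prop :=
  (∀ (t : ℕ) (x : Fin (t + 1) → X) (q : Fin t → M),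
    γ.enc t x q = (g t (S.predictor π₀ γ t q)).1 (x (Fin.last t))) ∧
  (∀ (t : ℕ) (q : Fin (t + 1) → M) (u : Fin t → U),
    γ.ctrl t q u =
      (g t (S.predictor π₀ γ t (Fin.init q))).2
        ((g t (S.predictor π₀ γ t (Fin.init q))).1, q (Fin.last t)))

/-- `J_β^N(π₀, γ) = E[∑_{k<N} β^k c(x_k, u_k)]`. -/
def Plant.finiteCost (S : Plant X U W) (c : X → U → ℝ) (β : ℝ) (π₀ : ProbabilityMeasure X)
    (γ : Policy X M U) (N : ℕ) : ℝ :=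
  ∫ ω, ∑ k ∈ Finset.range N, β ^ k * c (S.state γ k ω) (S.action γ k ω) ∂(S.prob π₀)

/-- `J_β(π₀, γ) = lim_{N → ∞} J_β^N(π₀, γ)`. -/
def Plant.discountedCost (S : Plant X U W) (c : X → U → ℝ) (β : ℝ) (π₀ : ProbabilityMeasure X)
    (γ : Policy X M U) : ℝ :=
  limUnder atTop (S.finiteCost c β π₀ γ)

/-- The cost `c̃(π, Q, η)` of the reformulated problem. -/
def reducedCost [Fintype X] (c : X → U → ℝ) (π : ProbabilityMeasure X)
    (a : Quantizer X M × ControlMap X M U) : ℝ :=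
  ∑ x, (π : Measure X).real {x} * c x (a.2 (a.1, a.1 x))

/-- `E[∑_{k<N} β^k c̃(π_k, Q_k, η_k)]`, where `(Q_k, η_k) = g k π_k`. -/
def Plant.finiteReducedCost [Fintype X] [DiscreteMeasurableSpace X] [Finite M] [Finite U]
    (S : Plant X U W) (c : X → U → ℝ) (β : ℝ) (π₀ : ProbabilityMeasure X) (γ : Policy X M U)
    (g : ℕ → ProbabilityMeasure X → Quantizer X M × ControlMap X M U) (N : ℕ) : ℝ :=
  ∫ ω, ∑ k ∈ Finset.range N,
    β ^ k * reducedCost c (S.predictor π₀ γ k (S.pastSymbols γ k ω))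
      (g k (S.predictor π₀ γ k (S.pastSymbols γ k ω))) ∂(S.prob π₀)

end

end CodingControl

end

/-! The predictor is carried unnormalized: for each realization `q` of the past symbols one keeps
the weights P(q_{[0,t-1]} = q, x_t = ·), which evolve linearly (`Plant.stateWeight_succ`). With a
value function that is positively homogeneous on the cone of nonnegative weights, no conditioning is
needed, and superadditivity on the cone is concavity in the belief. The Bellman operator preserves
both properties, so value iteration yields a superlinear fixed point `v`
(`exists_bellman_fixedPoint`).

Lower bound: an encoder that remembers old states acts, given the past symbols, like a randomized
choice of q_t given x_t. Such a kernel is a mixture of deterministic quantizers, and by concavity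
its cost is at least the average of theirs (`le_sum_stageValue_of_forall_quantizer`). Hence, under
every admissible policy, the expected value of `v` is at most the stage cost plus β times the next
expected value. Telescoping, with a terminal term that vanishes like β^N, gives
`Plant.value_le_discountedCost`.

Attainment: when `g` picks Bellman minimizers, q_t is a function of x_t once the past symbols are
fixed, and the same telescoping holds with equality
(`Plant.HasControlledPredictorStructure.discountedCost_eq`). Since there are finitely many pairs (Q,
η), a measurable `g` exists by taking the first minimizer. -/

noncomputable section

namespace CodingControl

/-! ### Superlinear value functions on the cone of unnormalized beliefs. -/

section Bellman

variable {X M U : Type*}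

/-- A positively homogeneous superadditive function on the cone of nonnegative functions. -/
structure IsSuperlinear (v : (X → ℝ) → ℝ) : Prop where
  add_le : ∀ ⦃μ ν : X → ℝ⦄, 0 ≤ μ → 0 ≤ ν → v μ + v ν ≤ v (μ + ν)
  map_smul : ∀ ⦃r : ℝ⦄ ⦃μ : X → ℝ⦄, 0 ≤ r → 0 ≤ μ → v (r • μ) = r * v μ

theorem IsSuperlinear.map_zero {v : (X → ℝ) → ℝ} (hv : IsSuperlinear v) : v 0 = 0 := by
  simpa using hv.map_smul (le_refl (0 : ℝ)) (le_refl (0 : X → ℝ))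

/-- Jensen's inequality for `v`; homogeneity makes the normalization ∑ p = 1 unnecessary. -/
theorem IsSuperlinear.sum_le {v : (X → ℝ) → ℝ} (hv : IsSuperlinear v) {ι : Type*}
    (s : Finset ι) (p : ι → ℝ) (μ : ι → X → ℝ) (hp : ∀ i ∈ s, 0 ≤ p i)
    (hμ : ∀ i ∈ s, 0 ≤ μ i) :
    ∑ i ∈ s, p i * v (μ i) ≤ v (∑ i ∈ s, p i • μ i) := by
  classical
  induction s using Finset.induction_on with
  | empty => simp [hv.map_zero]
  | insert a s ha ih =>
    rw [Finset.sum_insert ha, Finset.sum_insert ha]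
    have h1 := ih (fun i hi => hp i (Finset.mem_insert_of_mem hi))
      (fun i hi => hμ i (Finset.mem_insert_of_mem hi))
    have hpa := hp a (Finset.mem_insert_self a s)
    have hμa := hμ a (Finset.mem_insert_self a s)
    have h2 := hv.add_le (smul_nonneg hpa hμa) (Finset.sum_nonneg (s := s) (f := fun i => p i • μ i)
      fun i hi => smul_nonneg (hp i (Finset.mem_insert_of_mem hi))
        (hμ i (Finset.mem_insert_of_mem hi)))
    rw [hv.map_smul hpa hμa] at h2
    linarith

open Classical in
/-- The restriction of the weights `μ` to the cell `Q = m`. -/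
def cell (μ : X → ℝ) (Q : Quantizer X M) (m : M) : X → ℝ := fun x => if Q x = m then μ x else 0

theorem cell_nonneg {μ : X → ℝ} (hμ : 0 ≤ μ) (Q : Quantizer X M) (m : M) : 0 ≤ cell μ Q m := by
  intro x
  unfold cell
  split_ifs
  · exact hμ x
  · exact le_rfl

theorem cell_add (μ ν : X → ℝ) (Q : Quantizer X M) (m : M) :
    cell (μ + ν) Q m = cell μ Q m + cell ν Q m := by
  ext x
  by_cases h : Q x = m <;> simp [cell, h]

theorem cell_smul (r : ℝ) (μ : X → ℝ) (Q : Quantizer X M) (m : M) :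
    cell (r • μ) Q m = r • cell μ Q m := by
  ext x
  by_cases h : Q x = m <;> simp [cell, h]

theorem sum_cell [Fintype M] (μ : X → ℝ) (Q : Quantizer X M) (x : X) :
    ∑ m, cell μ Q m x = μ x := by
  classical
  simp [cell]

variable [Fintype X]

/-- The image of the measure with weights `ρ` under the transition kernel `K · u ·`. -/
def push (K : X → U → X → ℝ) (ρ : X → ℝ) (u : U) : X → ℝ := fun y => ∑ x, ρ x * K x u y

/-- The cost of applying the action `u` when the state has weights `ρ`, with terminal cost `v`. -/
def stageValue (c : X → U → ℝ) (K : X → U → X → ℝ) (β : ℝ) (v : (X → ℝ) → ℝ) (ρ : X → ℝ)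
    (u : U) : ℝ :=
  ∑ x, ρ x * c x u + β * v (push K ρ u)

theorem push_add (K : X → U → X → ℝ) (μ ν : X → ℝ) (u : U) :
    push K (μ + ν) u = push K μ u + push K ν u := by
  ext x
  simp [push, add_mul, Finset.sum_add_distrib]

theorem push_smul (K : X → U → X → ℝ) (r : ℝ) (μ : X → ℝ) (u : U) :
    push K (r • μ) u = r • push K μ u := by
  ext x
  simp [push, Finset.mul_sum, mul_assoc]

theorem push_nonneg {K : X → U → X → ℝ} (hK : ∀ x u x', 0 ≤ K x u x') {μ : X → ℝ} (hμ : 0 ≤ μ)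
    (u : U) : 0 ≤ push K μ u :=
  fun x' => Finset.sum_nonneg fun x _ => mul_nonneg (hμ x) (hK x u x')

theorem sum_push {K : X → U → X → ℝ} (hK : ∀ x u, ∑ x', K x u x' = 1) (μ : X → ℝ) (u : U) :
    ∑ x', push K μ u x' = ∑ x, μ x := by
  unfold push
  rw [Finset.sum_comm]
  simp [← Finset.mul_sum, hK]

/-- The running cost and `push` are linear in the weights, `push` stays in the cone, and β ≥ 0 keeps
the direction of the inequality. -/
theorem IsSuperlinear.stageValue {v : (X → ℝ) → ℝ} (hv : IsSuperlinear v) {K : X → U → X → ℝ}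
    (hK : ∀ x u x', 0 ≤ K x u x') (c : X → U → ℝ) {β : ℝ} (hβ : 0 ≤ β) (u : U) :
    IsSuperlinear fun ρ => stageValue c K β v ρ u where
  add_le μ ν hμ hν := by
    have := mul_le_mul_of_nonneg_left (hv.add_le (push_nonneg hK hμ u) (push_nonneg hK hν u)) hβ
    simp only [CodingControl.stageValue, push_add, Pi.add_apply, add_mul, Finset.sum_add_distrib]
    linarith
  map_smul r μ hr hμ := by
    simp only [CodingControl.stageValue, push_smul, hv.map_smul hr (push_nonneg hK hμ u),
      Pi.smul_apply, smul_eq_mul, mul_assoc, ← Finset.mul_sum]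
    ring

variable [Fintype M]

/-- The cost of the pair `a = (Q, η)` when the state has weights `μ`, with terminal cost `v`. -/
def actionValue (c : X → U → ℝ) (K : X → U → X → ℝ) (β : ℝ) (v : (X → ℝ) → ℝ) (μ : X → ℝ)
    (a : Quantizer X M × ControlMap X M U) : ℝ :=
  ∑ m, stageValue c K β v (cell μ a.1 m) (a.2 (a.1, m))

theorem IsSuperlinear.actionValue {v : (X → ℝ) → ℝ} (hv : IsSuperlinear v)
    {K : X → U → X → ℝ} (hK : ∀ x u x', 0 ≤ K x u x') (c : X → U → ℝ) {β : ℝ} (hβ : 0 ≤ β)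
    (a : Quantizer X M × ControlMap X M U) :
    IsSuperlinear fun μ => actionValue c K β v μ a where
  add_le μ ν hμ hν := by
    simp only [CodingControl.actionValue, cell_add, ← Finset.sum_add_distrib]
    exact Finset.sum_le_sum fun m _ =>
      (hv.stageValue hK c hβ _).add_le (cell_nonneg hμ _ _) (cell_nonneg hν _ _)
  map_smul r μ hr hμ := by
    simp only [CodingControl.actionValue, cell_smul, Finset.mul_sum]
    exact Finset.sum_congr rfl fun m _ =>
      (hv.stageValue hK c hβ _).map_smul hr (cell_nonneg hμ _ _)

/-- The law of a random quantizer with independent values has the prescribed marginals. -/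
theorem sum_prod_ite_eq (κ : X → M → ℝ) (hκ : ∀ x, ∑ m, κ x m = 1) (x₀ : X) (m : M)
    [DecidableEq X] [DecidableEq M] :
    ∑ Q : X → M, (∏ x, κ x (Q x)) * (if Q x₀ = m then 1 else 0) = κ x₀ m := by
  -- The indicator of `Q x₀ = m` is absorbed into the factor at `x₀`; every other factor then sums
  -- to 1.
  have h := Finset.prod_univ_sum (fun _ : X => (Finset.univ : Finset M))
    (fun x m' => κ x m' * (if x = x₀ then (if m' = m then 1 else 0) else 1))
  rw [Fintype.piFinset_univ] at h
  have h1 : ∏ x, ∑ m', κ x m' * (if x = x₀ then (if m' = m then (1 : ℝ) else 0) else 1)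
      = κ x₀ m := by
    rw [Finset.prod_eq_single x₀]
    · simp
    · intro x _ hx
      simp [hx, hκ]
    · simp
  rw [← h1, h]
  refine Finset.sum_congr rfl fun Q _ => ?_
  rw [Finset.prod_mul_distrib]
  simp

/-- Randomizing the quantizer does not lower the cost: a lower bound valid for all deterministic
quantizers is valid for every joint law `ν` of symbol and state. -/
theorem le_sum_stageValue_of_forall_quantizer {v : (X → ℝ) → ℝ} (hv : IsSuperlinear v)
    {K : X → U → X → ℝ} (hK : ∀ x u x', 0 ≤ K x u x') (c : X → U → ℝ) {β : ℝ} (hβ : 0 ≤ β)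
    [Nonempty M] (ν : M → X → ℝ) (hν : ∀ m, 0 ≤ ν m) (u : M → U) (B : ℝ)
    (hB : ∀ Q : Quantizer X M, B ≤ ∑ m, stageValue c K β v (cell (∑ m, ν m) Q m) (u m)) :
    B ≤ ∑ m, stageValue c K β v (ν m) (u m) := by
  classical
  set μ : X → ℝ := ∑ m, ν m with hμ_def
  have hμ : 0 ≤ μ := Finset.sum_nonneg fun m _ => hν m
  obtain ⟨m₀⟩ := ‹Nonempty M›
  -- The conditional law of the symbol given the state. On states of weight zero any probability
  -- vector serves; a point mass at `m₀` is used.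
  let κ : X → M → ℝ := fun x m =>
    if μ x = 0 then (if m = m₀ then 1 else 0) else ν m x / μ x
  have hμx : ∀ x, μ x = ∑ m, ν m x := fun x => by simp [hμ_def]
  have hκ_nonneg : ∀ x m, 0 ≤ κ x m := by
    intro x m
    simp only [κ]
    split_ifs
    · exact zero_le_one
    · exact le_rfl
    · exact div_nonneg (hν m x) (hμ x)
  have hκ_sum : ∀ x, ∑ m, κ x m = 1 := by
    intro x
    by_cases h : μ x = 0
    · simp [κ, h]
    · simp only [κ, h, if_false, ← Finset.sum_div]
      rw [← hμx, div_self h]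
  have hκ_mul : ∀ x m, κ x m * μ x = ν m x := by
    intro x m
    by_cases h : μ x = 0
    · have h0 : ν m x = 0 :=
        (Finset.sum_eq_zero_iff_of_nonneg (fun m _ => hν m x)).1 ((hμx x).symm.trans h) m
          (Finset.mem_univ m)
      simp [h, h0]
    · simp only [κ, h, if_false]
      exact div_mul_cancel₀ _ h
  -- The law of a random quantizer whose values at different states are drawn independently from
  -- `κ`. Only its one-point marginals matter, because `cell μ Q m` at `x` depends on `Q` through `Q
  -- x` alone.
  let p : (X → M) → ℝ := fun Q => ∏ x, κ x (Q x)
  have hp : ∀ Q, 0 ≤ p Q := fun Q => Finset.prod_nonneg fun x _ => hκ_nonneg x _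
  have hp_sum : ∑ Q, p Q = 1 := by
    have h := Finset.prod_univ_sum (fun _ : X => (Finset.univ : Finset M)) κ
    rw [Fintype.piFinset_univ] at h
    simp only [p, ← h, hκ_sum, Finset.prod_const_one]
  have hmix : ∀ m, ∑ Q, p Q • cell μ Q m = ν m := by
    intro m
    ext x
    rw [← hκ_mul x m, ← sum_prod_ite_eq κ hκ_sum x m, Finset.sum_mul]
    simp only [Finset.sum_apply, Pi.smul_apply, smul_eq_mul, p, cell]
    refine Finset.sum_congr rfl fun Q _ => ?_
    split_ifs <;> simp
  calc B = ∑ Q, p Q * B := by rw [← Finset.sum_mul, hp_sum, one_mul]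
    _ ≤ ∑ Q, p Q * ∑ m, stageValue c K β v (cell μ Q m) (u m) :=
        Finset.sum_le_sum fun Q _ => mul_le_mul_of_nonneg_left (hB Q) (hp Q)
    _ = ∑ m, ∑ Q, p Q * stageValue c K β v (cell μ Q m) (u m) := by
        simp only [Finset.mul_sum]
        exact Finset.sum_comm
    _ ≤ ∑ m, stageValue c K β v (ν m) (u m) := by
        refine Finset.sum_le_sum fun m _ => ?_
        have := (hv.stageValue hK c hβ (u m)).sum_le Finset.univ p (fun Q => cell μ Q m)
          (fun Q _ => hp Q) (fun Q _ => cell_nonneg hμ Q m)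
        rwa [hmix m] at this

/-- Transitions conserve mass and the cells of a quantizer partition it, so a bound proportional to
mass reproduces itself with a new constant. -/
theorem abs_actionValue_le {c : X → U → ℝ} {K : X → U → X → ℝ} {β B L : ℝ} {v : (X → ℝ) → ℝ}
    (hc : ∀ x u, |c x u| ≤ B) (hK : ∀ x u x', 0 ≤ K x u x') (hK₁ : ∀ x u, ∑ x', K x u x' = 1)
    (hβ : 0 ≤ β) (hv : ∀ μ, 0 ≤ μ → |v μ| ≤ L * ∑ x, μ x) {μ : X → ℝ} (hμ : 0 ≤ μ)
    (a : Quantizer X M × ControlMap X M U) :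
    |actionValue c K β v μ a| ≤ (B + β * L) * ∑ x, μ x := by
  have hstage : ∀ (ρ : X → ℝ) (u : U), 0 ≤ ρ →
      |stageValue c K β v ρ u| ≤ (B + β * L) * ∑ x, ρ x := by
    intro ρ u hρ
    have h1 : |∑ x, ρ x * c x u| ≤ B * ∑ x, ρ x := by
      rw [Finset.mul_sum]
      refine (Finset.abs_sum_le_sum_abs _ _).trans (Finset.sum_le_sum fun x _ => ?_)
      rw [abs_mul, abs_of_nonneg (hρ x), mul_comm]
      exact mul_le_mul_of_nonneg_right (hc x u) (hρ x)
    have h2 := hv _ (push_nonneg hK hρ u)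
    rw [sum_push hK₁] at h2
    calc |stageValue c K β v ρ u| ≤ |∑ x, ρ x * c x u| + |β * v (push K ρ u)| := abs_add_le _ _
      _ ≤ B * ∑ x, ρ x + β * (L * ∑ x, ρ x) := by
          rw [abs_mul, abs_of_nonneg hβ]
          exact add_le_add h1 (mul_le_mul_of_nonneg_left h2 hβ)
      _ = _ := by ring
  calc |actionValue c K β v μ a|
      ≤ ∑ m, |stageValue c K β v (cell μ a.1 m) (a.2 (a.1, m))| := Finset.abs_sum_le_sum_abs _ _
    _ ≤ ∑ m, (B + β * L) * ∑ x, cell μ a.1 m x :=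
        Finset.sum_le_sum fun m _ => hstage _ _ (cell_nonneg hμ _ _)
    _ = _ := by
        rw [← Finset.mul_sum, Finset.sum_comm]
        simp only [sum_cell]

theorem actionValue_mono {c : X → U → ℝ} {K : X → U → X → ℝ} {β : ℝ} {v v' : (X → ℝ) → ℝ}
    (hK : ∀ x u x', 0 ≤ K x u x') (hβ : 0 ≤ β) (h : ∀ μ, 0 ≤ μ → v μ ≤ v' μ) {μ : X → ℝ}
    (hμ : 0 ≤ μ) (a : Quantizer X M × ControlMap X M U) :
    actionValue c K β v μ a ≤ actionValue c K β v' μ a :=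
  Finset.sum_le_sum fun m _ => add_le_add le_rfl
    (mul_le_mul_of_nonneg_left (h _ (push_nonneg hK (cell_nonneg hμ _ m) _)) hβ)

/-! ### The Bellman operator and value iteration. -/

variable [Fintype U] [Nonempty M] [Nonempty U]

open Classical in
/-- The Bellman operator of the reformulated problem. -/
def bellman (M : Type*) [Fintype M] [Nonempty M] (c : X → U → ℝ) (K : X → U → X → ℝ) (β : ℝ)
    (v : (X → ℝ) → ℝ) (μ : X → ℝ) : ℝ :=
  Finset.univ.inf' Finset.univ_nonempty
    fun a : Quantizer X M × ControlMap X M U => actionValue c K β v μ a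

theorem bellman_le (c : X → U → ℝ) (K : X → U → X → ℝ) (β : ℝ) (v : (X → ℝ) → ℝ) (μ : X → ℝ)
    (a : Quantizer X M × ControlMap X M U) : bellman M c K β v μ ≤ actionValue c K β v μ a := by
  classical
  exact Finset.inf'_le _ (Finset.mem_univ a)

theorem le_bellman_iff (c : X → U → ℝ) (K : X → U → X → ℝ) (β : ℝ) (v : (X → ℝ) → ℝ)
    (μ : X → ℝ) (r : ℝ) :
    r ≤ bellman M c K β v μ ↔
      ∀ a : Quantizer X M × ControlMap X M U, r ≤ actionValue c K β v μ a := by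
  simp [bellman]

theorem exists_bellman_eq (c : X → U → ℝ) (K : X → U → X → ℝ) (β : ℝ) (v : (X → ℝ) → ℝ)
    (μ : X → ℝ) :
    ∃ a : Quantizer X M × ControlMap X M U, bellman M c K β v μ = actionValue c K β v μ a := by
  classical
  obtain ⟨a, -, ha⟩ := Finset.exists_mem_eq_inf' Finset.univ_nonempty
    fun a : Quantizer X M × ControlMap X M U => actionValue c K β v μ a
  exact ⟨a, ha⟩

/-- A minimum of superlinear functions is superlinear. -/
theorem IsSuperlinear.bellman {v : (X → ℝ) → ℝ} (hv : IsSuperlinear v)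
    {K : X → U → X → ℝ} (hK : ∀ x u x', 0 ≤ K x u x') (c : X → U → ℝ) {β : ℝ} (hβ : 0 ≤ β) :
    IsSuperlinear (bellman M c K β v) where
  add_le μ ν hμ hν := by
    rw [le_bellman_iff]
    intro a
    exact (add_le_add (bellman_le c K β v μ a) (bellman_le c K β v ν a)).trans
      ((hv.actionValue hK c hβ a).add_le hμ hν)
  map_smul r μ hr hμ := by
    apply le_antisymm
    · obtain ⟨a, ha⟩ := exists_bellman_eq (M := M) c K β v μ
      rw [ha, ← (hv.actionValue hK c hβ a).map_smul hr hμ]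
      exact bellman_le c K β v _ a
    · rw [le_bellman_iff]
      intro a
      rw [(hv.actionValue hK c hβ a).map_smul hr hμ]
      exact mul_le_mul_of_nonneg_left (bellman_le c K β v μ a) hr

theorem bellman_mono {c : X → U → ℝ} {K : X → U → X → ℝ} {β : ℝ} {v v' : (X → ℝ) → ℝ}
    (hK : ∀ x u x', 0 ≤ K x u x') (hβ : 0 ≤ β) (h : ∀ μ, 0 ≤ μ → v μ ≤ v' μ) {μ : X → ℝ}
    (hμ : 0 ≤ μ) : bellman M c K β v μ ≤ bellman M c K β v' μ := by
  rw [le_bellman_iff]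
  exact fun a => (bellman_le c K β v μ a).trans (actionValue_mono hK hβ h hμ a)

/-- Value iteration for the Bellman operator, started from `-L` times the total mass. -/
def valueIter (M : Type*) [Fintype M] [Nonempty M] (c : X → U → ℝ) (K : X → U → X → ℝ) (β L : ℝ) :
    ℕ → (X → ℝ) → ℝ
  | 0 => fun μ => -(L * ∑ x, μ x)
  | n + 1 => bellman M c K β (valueIter M c K β L n)

theorem isSuperlinear_valueIter {K : X → U → X → ℝ} (hK : ∀ x u x', 0 ≤ K x u x')
    (c : X → U → ℝ) {β : ℝ} (hβ : 0 ≤ β) (L : ℝ) (n : ℕ) :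
    IsSuperlinear (valueIter M c K β L n) := by
  induction n with
  | zero =>
    constructor
    · intro μ ν _ _
      simp only [valueIter, Pi.add_apply, Finset.sum_add_distrib]
      linarith
    · intro r μ _ _
      simp only [valueIter, Pi.smul_apply, smul_eq_mul, ← Finset.mul_sum]
      ring
  | succ n ih => exact ih.bellman hK c hβ

theorem abs_valueIter_le {c : X → U → ℝ} {K : X → U → X → ℝ} {β B L : ℝ}
    (hc : ∀ x u, |c x u| ≤ B) (hK : ∀ x u x', 0 ≤ K x u x') (hK₁ : ∀ x u, ∑ x', K x u x' = 1)
    (hβ : 0 ≤ β) (hL₀ : 0 ≤ L) (hL : B + β * L = L) (n : ℕ) (μ : X → ℝ) (hμ : 0 ≤ μ) :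
    |valueIter M c K β L n μ| ≤ L * ∑ x, μ x := by
  induction n generalizing μ with
  | zero =>
    simp only [valueIter, abs_neg]
    exact (abs_of_nonneg (mul_nonneg hL₀ (Finset.sum_nonneg fun x _ => hμ x))).le
  | succ n ih =>
    obtain ⟨a, ha⟩ := exists_bellman_eq (M := M) c K β (valueIter M c K β L n) μ
    rw [valueIter, ha]
    refine (abs_actionValue_le hc hK hK₁ hβ ih hμ a).trans ?_
    rw [hL]

/-- The starting function is the lowest one allowed by the bound of `abs_valueIter_le`, so the first
step goes up, and monotonicity of the operator propagates this. -/
theorem valueIter_le_succ {c : X → U → ℝ} {K : X → U → X → ℝ} {β B L : ℝ}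
    (hc : ∀ x u, |c x u| ≤ B) (hK : ∀ x u x', 0 ≤ K x u x') (hK₁ : ∀ x u, ∑ x', K x u x' = 1)
    (hβ : 0 ≤ β) (hL₀ : 0 ≤ L) (hL : B + β * L = L) (n : ℕ) (μ : X → ℝ) (hμ : 0 ≤ μ) :
    valueIter M c K β L n μ ≤ valueIter M c K β L (n + 1) μ := by
  induction n generalizing μ with
  | zero => exact (abs_le.1 (abs_valueIter_le hc hK hK₁ hβ hL₀ hL 1 μ hμ)).1
  | succ n ih => exact bellman_mono hK hβ ih hμ

/-- The Bellman equation has a superlinear measurable solution of linear growth. -/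
theorem exists_bellman_fixedPoint {c : X → U → ℝ} {K : X → U → X → ℝ} {β B L : ℝ}
    (hc : ∀ x u, |c x u| ≤ B) (hK : ∀ x u x', 0 ≤ K x u x') (hK₁ : ∀ x u, ∑ x', K x u x' = 1)
    (hβ : 0 ≤ β) (hL₀ : 0 ≤ L) (hL : B + β * L = L) :
    ∃ v : (X → ℝ) → ℝ, IsSuperlinear v ∧ (∀ μ, 0 ≤ μ → |v μ| ≤ L * ∑ x, μ x) ∧
      (∀ μ, 0 ≤ μ → v μ = bellman M c K β v μ) ∧
      Measurable fun μ : {μ : X → ℝ // 0 ≤ μ} => v μ := by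
  classical
  -- On the cone the iterates increase and are bounded, so the supremum is their limit and no
  -- contraction argument is needed.
  let v : (X → ℝ) → ℝ := fun μ => ⨆ n, valueIter M c K β L n μ
  have hlim : ∀ μ, 0 ≤ μ → Tendsto (fun n => valueIter M c K β L n μ) atTop (𝓝 (v μ)) := by
    intro μ hμ
    refine tendsto_atTop_ciSup
      (monotone_nat_of_le_succ fun n => valueIter_le_succ hc hK hK₁ hβ hL₀ hL n μ hμ)
      ⟨L * ∑ x, μ x, ?_⟩
    rintro _ ⟨n, rfl⟩
    exact (abs_le.1 (abs_valueIter_le hc hK hK₁ hβ hL₀ hL n μ hμ)).2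
  have hlim_action : ∀ μ, 0 ≤ μ → ∀ a : Quantizer X M × ControlMap X M U,
      Tendsto (fun n => actionValue c K β (valueIter M c K β L n) μ a) atTop
        (𝓝 (actionValue c K β v μ a)) := by
    intro μ hμ a
    exact tendsto_finsetSum _ fun m _ => tendsto_const_nhds.add
      ((hlim _ (push_nonneg hK (cell_nonneg hμ _ m) _)).const_mul β)
  have hcont : ∀ n, Continuous (valueIter M c K β L n) := by
    intro n
    induction n with
    | zero => unfold valueIter; fun_prop
    | succ n ih =>
      unfold valueIter bellman
      refine Continuous.finset_inf'_apply _ fun a _ => ?_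
      unfold actionValue stageValue
      have hcell : ∀ (Q : Quantizer X M) m, Continuous fun μ : X → ℝ => cell μ Q m := by
        intro Q m
        refine continuous_pi fun x => ?_
        unfold cell
        split_ifs <;> fun_prop
      have hpush : ∀ u, Continuous fun μ : X → ℝ => push K μ u := by
        intro u
        unfold push
        fun_prop
      refine continuous_finsetSum _ fun m _ => Continuous.add ?_ ?_
      · exact continuous_finsetSum _ fun x _ =>
          ((continuous_apply x).comp (hcell _ _)).mul continuous_const
      · exact continuous_const.mul (ih.comp ((hpush _).comp (hcell _ _)))
  refine ⟨v, ⟨?_, ?_⟩, ?_, ?_, ?_⟩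
  · intro μ ν hμ hν
    exact le_of_tendsto_of_tendsto' ((hlim μ hμ).add (hlim ν hν)) (hlim _ (add_nonneg hμ hν))
      fun n => (isSuperlinear_valueIter hK c hβ L n).add_le hμ hν
  · intro r μ hr hμ
    refine tendsto_nhds_unique (hlim _ (smul_nonneg hr hμ)) (((hlim μ hμ).const_mul r).congr ?_)
    exact fun n => ((isSuperlinear_valueIter hK c hβ L n).map_smul hr hμ).symm
  · intro μ hμ
    exact le_of_tendsto' (hlim μ hμ).abs
      fun n => abs_valueIter_le hc hK hK₁ hβ hL₀ hL n μ hμ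
  -- A minimum over finitely many actions commutes with the limit, so the recursion passes to the
  -- fixed-point equation.
  · intro μ hμ
    refine tendsto_nhds_unique ((tendsto_add_atTop_iff_nat 1).2 (hlim μ hμ)) ?_
    exact Tendsto.finset_inf'_nhds_apply _ fun a _ => hlim_action μ hμ a
  -- Convergence is known only on the cone, hence measurability is claimed on the subtype.
  · refine measurable_of_tendsto_metrizable
      (f := fun n (μ : {μ : X → ℝ // 0 ≤ μ}) => valueIter M c K β L n μ)
      (fun n => (hcont n).measurable.comp measurable_subtype_coe) ?_
    rw [tendsto_pi_nhds]
    exact fun μ => hlim μ μ.2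

end Bellman

/-! ### Measures and integrals through finite-valued maps. -/

section FiniteValued

variable {Ω α : Type*} [MeasurableSpace Ω] [Fintype α]

theorem measureReal_eq_sum_inter_fiber (P : Measure Ω) [IsFiniteMeasure P] (φ : Ω → α)
    (hφ : ∀ a, MeasurableSet {ω | φ ω = a}) {A : Set Ω} (hA : MeasurableSet A) :
    P.real A = ∑ a, P.real (A ∩ {ω | φ ω = a}) := by
  have hU : A = ⋃ a, A ∩ {ω | φ ω = a} := by
    ext ω
    simp
  conv_lhs => rw [hU]
  refine measureReal_iUnion_fintype ?_ fun a => hA.inter (hφ a)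
  intro a b hab
  refine Set.disjoint_left.2 ?_
  rintro ω ⟨-, h1⟩ ⟨-, h2⟩
  exact hab (Eq.trans (Eq.symm h1) h2)

theorem integrable_comp_of_finite (P : Measure Ω) [IsFiniteMeasure P] (φ : Ω → α)
    (hφ : ∀ a, MeasurableSet {ω | φ ω = a}) (F : α → ℝ) : Integrable (fun ω => F (φ ω)) P := by
  let _ : MeasurableSpace α := ⊤
  have hm : Measurable φ := measurable_to_countable' hφ
  exact (Integrable.of_finite (μ := P.map φ) (f := F)).comp_measurable hm

theorem integral_comp_of_finite (P : Measure Ω) [IsFiniteMeasure P] (φ : Ω → α)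
    (hφ : ∀ a, MeasurableSet {ω | φ ω = a}) (F : α → ℝ) :
    ∫ ω, F (φ ω) ∂P = ∑ a, P.real {ω | φ ω = a} * F a := by
  let _ : MeasurableSpace α := ⊤
  have hm : Measurable φ := measurable_to_countable' hφ
  rw [← integral_map hm.aemeasurable (f := F) (by fun_prop), integral_fintype .of_finite]
  refine Finset.sum_congr rfl fun a _ => ?_
  rw [map_measureReal_apply hm (measurableSet_singleton a)]
  rfl

end FiniteValued

theorem sum_fin_succ_function {M : Type*} [Fintype M] (t : ℕ) (F : (Fin (t + 1) → M) → ℝ) :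
    ∑ q, F q = ∑ q : Fin t → M, ∑ m, F (Fin.snoc q m) := by
  rw [← (Fin.snocEquiv fun _ : Fin (t + 1) => M).sum_comp, Fintype.sum_prod_type, Finset.sum_comm]
  rfl

/-! ### Closed-loop dynamics and independence of the current noise from the history. -/

section ClosedLoop

variable {X M U W : Type*} [MeasurableSpace X] [MeasurableSpace W]

/-- The channel symbol `q_t`. -/
def Plant.symbol (S : Plant X U W) (γ : Policy X M U) (t : ℕ) (ω : X × (ℕ → W)) : M :=
  γ.enc t (S.hist γ ω t).1 (S.hist γ ω t).2.1

/-- The actions `u_{[0,t-1]}` as a function of the symbols `q_{[0,t-1]}`. -/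
def Policy.controls (γ : Policy X M U) : (t : ℕ) → (Fin t → M) → Fin t → U
  | 0 => fun _ => Fin.elim0
  | t + 1 => fun q =>
    Fin.snoc (γ.controls t (Fin.init q)) (γ.ctrl t q (γ.controls t (Fin.init q)))

/-- The action `u_t` as a function of the symbols `q_{[0,t]}`. -/
def Policy.control (γ : Policy X M U) (t : ℕ) (q : Fin (t + 1) → M) : U :=
  γ.ctrl t q (γ.controls t (Fin.init q))

theorem Plant.pastSymbols_succ (S : Plant X U W) (γ : Policy X M U) (t : ℕ)
    (ω : X × (ℕ → W)) :
    S.pastSymbols γ (t + 1) ω = Fin.snoc (S.pastSymbols γ t ω) (S.symbol γ t ω) := rfl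

/-- Controllers are deterministic, so past actions carry no information beyond the symbols and can
be dropped from the controller's memory. -/
theorem Plant.hist_controls (S : Plant X U W) (γ : Policy X M U) (t : ℕ) (ω : X × (ℕ → W)) :
    (S.hist γ ω t).2.2 = γ.controls t (S.pastSymbols γ t ω) := by
  induction t with
  | zero => rfl
  | succ t ih =>
    simp only [Policy.controls, S.pastSymbols_succ, Fin.init_snoc, ← ih]
    rfl

theorem Plant.action_eq (S : Plant X U W) (γ : Policy X M U) (t : ℕ) (ω : X × (ℕ → W)) :
    S.action γ t ω = γ.control t (Fin.snoc (S.pastSymbols γ t ω) (S.symbol γ t ω)) := by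
  simp only [Plant.action, Plant.hist_controls, Policy.controls, Fin.snoc_last]
  rfl

theorem Plant.state_succ (S : Plant X U W) (γ : Policy X M U) (t : ℕ) (ω : X × (ℕ → W)) :
    S.state γ (t + 1) ω = S.f (S.state γ t ω) (S.action γ t ω) (ω.2 t) := by
  simp only [Plant.state, Plant.action, Plant.hist, Plant.step, Fin.snoc_last]

/-- The history up to time `t` depends only on the noise before time `t`. -/
theorem Plant.hist_congr (S : Plant X U W) (γ : Policy X M U) (t : ℕ) (x : X) (w w' : ℕ → W)
    (h : ∀ i < t, w i = w' i) : S.hist γ (x, w) t = S.hist γ (x, w') t := by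
  induction t with
  | zero => rfl
  | succ t ih =>
    simp only [Plant.hist, ih fun i hi => h i (hi.trans t.lt_succ_self), h t t.lt_succ_self]

/-- The history up to time `t` depends only on the policy before time `t`. -/
theorem Plant.hist_congr_policy (S : Plant X U W) (γ γ' : Policy X M U) (t : ℕ)
    (ω : X × (ℕ → W)) (he : ∀ s < t, γ.enc s = γ'.enc s) (hc : ∀ s < t, γ.ctrl s = γ'.ctrl s) :
    S.hist γ ω t = S.hist γ' ω t := by
  induction t with
  | zero => rfl
  | succ t ih =>
    simp only [Plant.hist, Plant.step, he t t.lt_succ_self, hc t t.lt_succ_self,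
      ih (fun s hs => he s (hs.trans t.lt_succ_self)) fun s hs => hc s (hs.trans t.lt_succ_self)]

variable [DiscreteMeasurableSpace X]

theorem Plant.measurableSet_hist [Finite X] [Finite M] [Finite U] (S : Plant X U W)
    (γ : Policy X M U) (t : ℕ) (A : Set ((Fin (t + 1) → X) × (Fin t → M) × (Fin t → U))) :
    MeasurableSet {ω | S.hist γ ω t ∈ A} := by
  have key : ∀ h, MeasurableSet {ω | S.hist γ ω t = h} := by
    induction t with
    | zero =>
      intro h
      exact measurable_fst (MeasurableSet.of_discrete (s := {x : X |
        ((fun _ => x, Fin.elim0, Fin.elim0) : (Fin 1 → X) × (Fin 0 → M) × (Fin 0 → U)) = h}))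
    | succ t ih =>
      intro h
      have : {ω : X × (ℕ → W) | S.hist γ ω (t + 1) = h}
          = ⋃ h', ({ω | S.hist γ ω t = h'} ∩
              (fun ω => ω.2 t) ⁻¹' {w | S.step γ t h' w = h}) := by
        ext ω
        simp [Plant.hist]
      rw [this]
      -- The type of `A` depends on `t`, so the induction generalizes `A`; the claim does not
      -- involve it, and `Set.univ` is an arbitrary choice.
      refine MeasurableSet.iUnion fun h' => (ih Set.univ h').inter ?_
      refine ((measurable_pi_apply t).comp measurable_snd) ?_
      exact S.measurable_f (h'.1 (Fin.last t))
        (γ.ctrl t (Fin.snoc h'.2.1 (γ.enc t h'.1 h'.2.1)) h'.2.2)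
        (MeasurableSet.of_discrete (s := {x | ((Fin.snoc h'.1 x,
          Fin.snoc h'.2.1 (γ.enc t h'.1 h'.2.1),
          Fin.snoc h'.2.2 (γ.ctrl t (Fin.snoc h'.2.1 (γ.enc t h'.1 h'.2.1)) h'.2.2)) :
          (Fin (t + 2) → X) × (Fin (t + 1) → M) × (Fin (t + 1) → U)) = h}))
  have : {ω | S.hist γ ω t ∈ A} = ⋃ h : A, {ω | S.hist γ ω t = h.1} := by
    ext ω
    simp
  rw [this]
  exact MeasurableSet.iUnion fun h => key h.1

/-- The history up to time `t` is independent of the noise at time `t`. -/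
theorem Plant.measureReal_hist_inter_noise [Finite X] [Finite M] [Finite U] (S : Plant X U W)
    (π₀ : ProbabilityMeasure X) (γ : Policy X M U) (t : ℕ)
    (A : Set ((Fin (t + 1) → X) × (Fin t → M) × (Fin t → U))) {B : Set W} (hB : MeasurableSet B) :
    (S.prob π₀).real ({ω | S.hist γ ω t ∈ A} ∩ {ω | ω.2 t ∈ B})
      = (S.prob π₀).real {ω | S.hist γ ω t ∈ A} * S.noise.real B := by
  have := S.isProbabilityMeasure_noise
  have hA := S.measurableSet_hist γ t A
  have hBt : MeasurableSet {ω : X × (ℕ → W) | ω.2 t ∈ B} :=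
    ((measurable_pi_apply t).comp measurable_snd) hB
  obtain ⟨w₀⟩ : Nonempty W := nonempty_of_isProbabilityMeasure S.noise
  -- Padding the first `t` noise values with `w₀` exhibits the history event as a function of those
  -- coordinates, to which independence of finite blocks applies.
  let ext : (Finset.range t → W) → ℕ → W := fun w i =>
    if h : i ∈ Finset.range t then w ⟨i, h⟩ else w₀
  have hext : Measurable ext := by
    refine measurable_pi_lambda _ fun i => ?_
    by_cases h : i ∈ Finset.range t
    · simpa only [ext, h, dif_pos] using measurable_pi_apply _
    · simpa only [ext, h, dif_neg, not_false_eq_true] using measurable_const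
  have hind : IndepFun (fun (w : ℕ → W) (i : Finset.range t) => w i)
      (fun (w : ℕ → W) (i : ({t} : Finset ℕ)) => w i) (Measure.infinitePi fun _ => S.noise) :=
    (iIndepFun_infinitePi (P := fun _ : ℕ => S.noise) (X := fun _ w => w)
      fun _ => measurable_id).indepFun_finset (Finset.range t) {t} (by simp)
      fun i => measurable_pi_apply i
  -- Independence is proved on each slice of fixed initial state and then integrated over x₀.
  have hsec : ∀ x, Measure.infinitePi (fun _ : ℕ => S.noise)
      (Prod.mk x ⁻¹' ({ω | S.hist γ ω t ∈ A} ∩ {ω | ω.2 t ∈ B}))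
      = Measure.infinitePi (fun _ : ℕ => S.noise) (Prod.mk x ⁻¹' {ω | S.hist γ ω t ∈ A})
        * S.noise B := by
    intro x
    have h1 : Prod.mk x ⁻¹' {ω | S.hist γ ω t ∈ A}
        = (fun (w : ℕ → W) (i : Finset.range t) => w i) ⁻¹'
          (ext ⁻¹' (Prod.mk x ⁻¹' {ω | S.hist γ ω t ∈ A})) := by
      ext w
      simp only [Set.mem_preimage, Set.mem_ofPred_eq]
      rw [S.hist_congr γ t x w (ext fun i => w i)]
      intro i hi
      simp [ext, hi]
    have h2 : Prod.mk x ⁻¹' {ω : X × (ℕ → W) | ω.2 t ∈ B}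
        = (fun (w : ℕ → W) (i : ({t} : Finset ℕ)) => w i) ⁻¹'
          ((fun w => w ⟨t, Finset.mem_singleton_self t⟩) ⁻¹' B) := rfl
    have h3 : Measure.infinitePi (fun _ : ℕ => S.noise)
        (Prod.mk x ⁻¹' {ω : X × (ℕ → W) | ω.2 t ∈ B}) = S.noise B := by
      have h := congrArg (fun ν => ν B) (Measure.infinitePi_map_eval (fun _ : ℕ => S.noise) t)
      rwa [Measure.map_apply (measurable_pi_apply t) hB] at h
    have h4 := hind.measure_inter_preimage_eq_mul _ _
      (hext (measurable_prodMk_left (x := x) hA))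
      ((measurable_pi_apply (⟨t, Finset.mem_singleton_self t⟩ : ({t} : Finset ℕ))) hB)
    rw [← h1, ← h2, h3] at h4
    rw [Set.preimage_inter, h4]
  rw [measureReal_def, measureReal_def, measureReal_def, ← ENNReal.toReal_mul]
  congr 1
  unfold Plant.prob
  rw [Measure.prod_apply (hA.inter hBt), Measure.prod_apply hA]
  simp_rw [hsec]
  rw [lintegral_mul_const _ (measurable_measure_prodMk_left hA)]

end ClosedLoop

/-! ### Unnormalized filter weights, cost formulas and the lower bound. -/

section Weights

variable {X M U W : Type*} [MeasurableSpace X] [MeasurableSpace W]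

/-- The transition probability `P(x_{t+1} = x' | x_t = x, u_t = u)`. -/
def Plant.transition (S : Plant X U W) (x : X) (u : U) (x' : X) : ℝ :=
  S.noise.real {w | S.f x u w = x'}

theorem Plant.transition_nonneg (S : Plant X U W) (x : X) (u : U) (x' : X) :
    0 ≤ S.transition x u x' := measureReal_nonneg

theorem Plant.sum_transition [Fintype X] [DiscreteMeasurableSpace X] (S : Plant X U W) (x : X)
    (u : U) : ∑ x', S.transition x u x' = 1 := by
  have := S.isProbabilityMeasure_noise
  have h := measureReal_eq_sum_inter_fiber S.noise (S.f x u)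
    (fun x' => S.measurable_f x u (measurableSet_singleton x')) MeasurableSet.univ
  simpa [Plant.transition] using h.symm

theorem Plant.coe_predictor_of_ne_zero [Finite X] [DiscreteMeasurableSpace X] [Finite M]
    [Finite U] (S : Plant X U W) (π₀ : ProbabilityMeasure X) (γ : Policy X M U) (t : ℕ)
    (q : Fin t → M) (hq : S.prob π₀ {ω | S.pastSymbols γ t ω = q} ≠ 0) :
    (S.predictor π₀ γ t q : Measure X)
      = (cond (S.prob π₀) {ω | S.pastSymbols γ t ω = q}).map (S.state γ t) :=
  congrArg Subtype.val (dif_pos hq)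

theorem Plant.predictor_of_eq_zero [Finite X] [DiscreteMeasurableSpace X] [Finite M]
    [Finite U] (S : Plant X U W) (π₀ : ProbabilityMeasure X) (γ : Policy X M U) (t : ℕ)
    (q : Fin t → M) (hq : S.prob π₀ {ω | S.pastSymbols γ t ω = q} = 0) :
    S.predictor π₀ γ t q = π₀ :=
  dif_neg (not_not_intro hq)

/-- The weights `P(q_{[0,t-1]} = q, x_t = x)`. -/
def Plant.stateWeight (S : Plant X U W) (π₀ : ProbabilityMeasure X) (γ : Policy X M U) (t : ℕ)
    (q : Fin t → M) (x : X) : ℝ :=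
  (S.prob π₀).real {ω | S.pastSymbols γ t ω = q ∧ S.state γ t ω = x}

/-- The weights `P(q_{[0,t-1]} = q, q_t = m, x_t = x)`. -/
def Plant.jointWeight (S : Plant X U W) (π₀ : ProbabilityMeasure X) (γ : Policy X M U) (t : ℕ)
    (q : Fin t → M) (m : M) (x : X) : ℝ :=
  (S.prob π₀).real {ω | S.pastSymbols γ t ω = q ∧ S.symbol γ t ω = m ∧ S.state γ t ω = x}

theorem Plant.stateWeight_nonneg (S : Plant X U W) (π₀ : ProbabilityMeasure X)
    (γ : Policy X M U) (t : ℕ) (q : Fin t → M) : 0 ≤ S.stateWeight π₀ γ t q :=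
  fun _ => measureReal_nonneg

theorem Plant.jointWeight_nonneg (S : Plant X U W) (π₀ : ProbabilityMeasure X)
    (γ : Policy X M U) (t : ℕ) (q : Fin t → M) (m : M) : 0 ≤ S.jointWeight π₀ γ t q m :=
  fun _ => measureReal_nonneg

theorem Plant.stateWeight_zero (S : Plant X U W) (π₀ : ProbabilityMeasure X)
    (γ : Policy X M U) (q : Fin 0 → M) (x : X) :
    S.stateWeight π₀ γ 0 q x = (π₀ : Measure X).real {x} := by
  have := S.isProbabilityMeasure_noise
  have h : {ω : X × (ℕ → W) | S.pastSymbols γ 0 ω = q ∧ S.state γ 0 ω = x}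
      = {x} ×ˢ Set.univ := by
    ext ω
    have : S.pastSymbols γ 0 ω = q := Subsingleton.elim _ _
    simp [this, Plant.state, Plant.hist]
  rw [Plant.stateWeight, h, Plant.prob, measureReal_prod_prod]
  simp

theorem Plant.abs_integral_cost_le (S : Plant X U W) {c : X → U → ℝ} {B : ℝ}
    (hc : ∀ x u, |c x u| ≤ B) (π₀ : ProbabilityMeasure X) (γ : Policy X M U) (t : ℕ) :
    |∫ ω, c (S.state γ t ω) (S.action γ t ω) ∂(S.prob π₀)| ≤ B := by
  have h := norm_integral_le_of_norm_le_const (μ := S.prob π₀)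
    (f := fun ω => c (S.state γ t ω) (S.action γ t ω)) (C := B)
    (Eventually.of_forall fun ω => hc _ _)
  simpa using h

theorem Plant.sum_value_zero (S : Plant X U W) (π₀ : ProbabilityMeasure X)
    [Fintype M] (γ : Policy X M U) (v : (X → ℝ) → ℝ) :
    ∑ q, v (S.stateWeight π₀ γ 0 q) = v fun x => (π₀ : Measure X).real {x} := by
  rw [Fintype.sum_unique]
  congr 1
  ext x
  exact S.stateWeight_zero π₀ γ _ x

variable [Fintype X] [DiscreteMeasurableSpace X] [Fintype M] [Finite U]

theorem Plant.measurableSet_joint (S : Plant X U W) (γ : Policy X M U) (t : ℕ)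
    (A : Set ((Fin t → M) × M × X)) :
    MeasurableSet {ω | (S.pastSymbols γ t ω, S.symbol γ t ω, S.state γ t ω) ∈ A} :=
  S.measurableSet_hist γ t {h | (h.2.1, γ.enc t h.1 h.2.1, h.1 (Fin.last t)) ∈ A}

theorem Plant.sum_jointWeight (S : Plant X U W) (π₀ : ProbabilityMeasure X)
    (γ : Policy X M U) (t : ℕ) (q : Fin t → M) :
    ∑ m, S.jointWeight π₀ γ t q m = S.stateWeight π₀ γ t q := by
  ext x
  have h := measureReal_eq_sum_inter_fiber (S.prob π₀) (S.symbol γ t)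
    (fun m => S.measurableSet_joint γ t {p | p.2.1 = m})
    (S.measurableSet_joint γ t {p | p.1 = q ∧ p.2.2 = x})
  rw [Finset.sum_apply]
  refine (h.trans (Finset.sum_congr rfl fun m _ => ?_)).symm
  rw [Plant.jointWeight]
  congr 1
  ext ω
  simp only [Set.mem_inter_iff, Set.mem_ofPred_eq]
  tauto

theorem Plant.sum_stateWeight (S : Plant X U W) (π₀ : ProbabilityMeasure X)
    (γ : Policy X M U) (t : ℕ) (q : Fin t → M) :
    ∑ x, S.stateWeight π₀ γ t q x = (S.prob π₀).real {ω | S.pastSymbols γ t ω = q} := by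
  have h := measureReal_eq_sum_inter_fiber (S.prob π₀) (S.state γ t)
    (fun x => S.measurableSet_joint γ t {p | p.2.2 = x})
    (S.measurableSet_joint γ t {p | p.1 = q})
  exact h.symm

theorem Plant.sum_sum_stateWeight (S : Plant X U W) (π₀ : ProbabilityMeasure X)
    (γ : Policy X M U) (t : ℕ) : ∑ q, ∑ x, S.stateWeight π₀ γ t q x = 1 := by
  have h := measureReal_eq_sum_inter_fiber (S.prob π₀) (S.pastSymbols γ t)
    (fun q => S.measurableSet_joint γ t {p | p.1 = q}) MeasurableSet.univ
  simp only [probReal_univ, Set.univ_inter] at h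
  simp only [S.sum_stateWeight, ← h]

/-- The filter recursion without its normalization, hence linear. Fixing `q` and `m` fixes the
action, and w_t is independent of the history. -/
theorem Plant.stateWeight_succ (S : Plant X U W) (π₀ : ProbabilityMeasure X)
    (γ : Policy X M U) (t : ℕ) (q : Fin t → M) (m : M) :
    S.stateWeight π₀ γ (t + 1) (Fin.snoc q m)
      = push S.transition (S.jointWeight π₀ γ t q m) (γ.control t (Fin.snoc q m)) := by
  ext x'
  have h := measureReal_eq_sum_inter_fiber (S.prob π₀) (S.state γ t)
    (fun x => S.measurableSet_joint γ t {p | p.2.2 = x})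
    (S.measurableSet_joint γ (t + 1) {p | p.1 = Fin.snoc q m ∧ p.2.2 = x'})
  refine h.trans (Finset.sum_congr rfl fun x _ => ?_)
  have h2 := S.measureReal_hist_inter_noise π₀ γ t
    {h | h.2.1 = q ∧ γ.enc t h.1 h.2.1 = m ∧ h.1 (Fin.last t) = x}
    (S.measurable_f x (γ.control t (Fin.snoc q m)) (measurableSet_singleton x'))
  refine Eq.trans ?_ h2
  congr 1
  ext ω
  change ((S.pastSymbols γ (t + 1) ω = Fin.snoc q m ∧ S.state γ (t + 1) ω = x')
      ∧ S.state γ t ω = x) ↔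
    (S.pastSymbols γ t ω = q ∧ S.symbol γ t ω = m ∧ S.state γ t ω = x) ∧
      S.f x (γ.control t (Fin.snoc q m)) (ω.2 t) = x'
  rw [S.state_succ, S.action_eq, S.pastSymbols_succ, Fin.snoc_inj]
  constructor
  · rintro ⟨⟨⟨rfl, rfl⟩, hf⟩, rfl⟩
    exact ⟨⟨rfl, rfl, rfl⟩, hf⟩
  · rintro ⟨⟨rfl, rfl, rfl⟩, hf⟩
    exact ⟨⟨⟨rfl, rfl⟩, hf⟩, rfl⟩

theorem Plant.integrable_cost (S : Plant X U W) (c : X → U → ℝ) (π₀ : ProbabilityMeasure X)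
    (γ : Policy X M U) (t : ℕ) :
    Integrable (fun ω => c (S.state γ t ω) (S.action γ t ω)) (S.prob π₀) := by
  simp only [S.action_eq]
  exact integrable_comp_of_finite (S.prob π₀)
    (fun ω => (S.pastSymbols γ t ω, S.symbol γ t ω, S.state γ t ω))
    (fun a => S.measurableSet_joint γ t {p | p = a})
    (fun p => c p.2.2 (γ.control t (Fin.snoc p.1 p.2.1)))

theorem Plant.integral_cost (S : Plant X U W) (c : X → U → ℝ) (π₀ : ProbabilityMeasure X)
    (γ : Policy X M U) (t : ℕ) :
    ∫ ω, c (S.state γ t ω) (S.action γ t ω) ∂(S.prob π₀)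
      = ∑ q, ∑ m, ∑ x, S.jointWeight π₀ γ t q m x * c x (γ.control t (Fin.snoc q m)) := by
  simp only [S.action_eq]
  have h := integral_comp_of_finite (S.prob π₀)
    (fun ω => (S.pastSymbols γ t ω, S.symbol γ t ω, S.state γ t ω))
    (fun a => S.measurableSet_joint γ t {p | p = a})
    (fun p => c p.2.2 (γ.control t (Fin.snoc p.1 p.2.1)))
  rw [h]
  simp only [Fintype.sum_prod_type, Plant.jointWeight, Prod.mk.injEq]

theorem Plant.finiteCost_eq (S : Plant X U W) (c : X → U → ℝ) (β : ℝ)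
    (π₀ : ProbabilityMeasure X) (γ : Policy X M U) (N : ℕ) :
    S.finiteCost c β π₀ γ N
      = ∑ k ∈ Finset.range N, β ^ k * ∫ ω, c (S.state γ k ω) (S.action γ k ω) ∂(S.prob π₀) := by
  rw [Plant.finiteCost, integral_finsetSum _ fun k _ => (S.integrable_cost c π₀ γ k).const_mul _]
  simp only [integral_const_mul]

theorem Plant.tendsto_finiteCost (S : Plant X U W) (c : X → U → ℝ) {β B : ℝ} (hβ₀ : 0 ≤ β)
    (hβ₁ : β < 1) (hc : ∀ x u, |c x u| ≤ B) (π₀ : ProbabilityMeasure X) (γ : Policy X M U) :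
    Tendsto (S.finiteCost c β π₀ γ) atTop (𝓝 (S.discountedCost c β π₀ γ)) := by
  refine tendsto_nhds_limUnder ?_
  have hsum : Summable fun k =>
      β ^ k * ∫ ω, c (S.state γ k ω) (S.action γ k ω) ∂(S.prob π₀) := by
    refine Summable.of_norm_bounded ((summable_geometric_of_lt_one hβ₀ hβ₁).mul_right B) ?_
    intro k
    rw [norm_mul, norm_pow, Real.norm_of_nonneg hβ₀]
    exact mul_le_mul_of_nonneg_left (S.abs_integral_cost_le hc π₀ γ k) (pow_nonneg hβ₀ k)
  refine ⟨_, hsum.hasSum.tendsto_sum_nat.congr fun N => ?_⟩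
  exact (S.finiteCost_eq c β π₀ γ N).symm

/-- The expected cost at time `t` plus the discounted terminal cost at time `t + 1`. -/
theorem Plant.integral_cost_add_sum (S : Plant X U W) (c : X → U → ℝ) (β : ℝ)
    (π₀ : ProbabilityMeasure X) (γ : Policy X M U) (v : (X → ℝ) → ℝ) (t : ℕ) :
    ∫ ω, c (S.state γ t ω) (S.action γ t ω) ∂(S.prob π₀)
        + β * ∑ q, v (S.stateWeight π₀ γ (t + 1) q)
      = ∑ q, ∑ m, stageValue c S.transition β v (S.jointWeight π₀ γ t q m)
          (γ.control t (Fin.snoc q m)) := by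
  rw [S.integral_cost, sum_fin_succ_function]
  simp only [S.stateWeight_succ, stageValue, Finset.mul_sum, Finset.sum_add_distrib]

/-- The weights have total mass one at every time, so the bound is uniform in `t`. -/
theorem Plant.abs_sum_value_le (S : Plant X U W) (π₀ : ProbabilityMeasure X)
    (γ : Policy X M U) {v : (X → ℝ) → ℝ} {L : ℝ} (hv : ∀ μ, 0 ≤ μ → |v μ| ≤ L * ∑ x, μ x)
    (t : ℕ) : |∑ q, v (S.stateWeight π₀ γ t q)| ≤ L := by
  calc |∑ q, v (S.stateWeight π₀ γ t q)| ≤ ∑ q, |v (S.stateWeight π₀ γ t q)| :=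
        Finset.abs_sum_le_sum_abs _ _
    _ ≤ ∑ q, L * ∑ x, S.stateWeight π₀ γ t q x :=
        Finset.sum_le_sum fun q _ => hv _ (S.stateWeight_nonneg π₀ γ t q)
    _ = L := by rw [← Finset.mul_sum, S.sum_sum_stateWeight, mul_one]

theorem Plant.tendsto_pow_mul_sum_value (S : Plant X U W) (π₀ : ProbabilityMeasure X)
    (γ : Policy X M U) {v : (X → ℝ) → ℝ} {L : ℝ} (hv : ∀ μ, 0 ≤ μ → |v μ| ≤ L * ∑ x, μ x)
    {β : ℝ} (hβ₀ : 0 ≤ β) (hβ₁ : β < 1) :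
    Tendsto (fun t => β ^ t * ∑ q, v (S.stateWeight π₀ γ t q)) atTop (𝓝 0) := by
  refine squeeze_zero_norm (a := fun t => β ^ t * L) (fun t => ?_) ?_
  · rw [norm_mul, norm_pow, Real.norm_of_nonneg hβ₀]
    exact mul_le_mul_of_nonneg_left (S.abs_sum_value_le π₀ γ hv t) (pow_nonneg hβ₀ t)
  · simpa using (tendsto_pow_atTop_nhds_zero_of_lt_one hβ₀ hβ₁).mul_const L

/-- No admissible policy has a smaller cost than a superlinear solution of the Bellman
inequality. -/
theorem Plant.value_le_discountedCost (S : Plant X U W) {c : X → U → ℝ} {β B L : ℝ}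
    (hβ₀ : 0 ≤ β) (hβ₁ : β < 1) (hc : ∀ x u, |c x u| ≤ B) [Nonempty M] {v : (X → ℝ) → ℝ}
    (hv : IsSuperlinear v) (hvL : ∀ μ, 0 ≤ μ → |v μ| ≤ L * ∑ x, μ x)
    (hbellman : ∀ μ, 0 ≤ μ → ∀ a : Quantizer X M × ControlMap X M U,
      v μ ≤ actionValue c S.transition β v μ a)
    (π₀ : ProbabilityMeasure X) (γ : Policy X M U) :
    v (fun x => (π₀ : Measure X).real {x}) ≤ S.discountedCost c β π₀ γ := by
  have hstep : ∀ t, ∑ q, v (S.stateWeight π₀ γ t q)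
      ≤ ∫ ω, c (S.state γ t ω) (S.action γ t ω) ∂(S.prob π₀)
        + β * ∑ q, v (S.stateWeight π₀ γ (t + 1) q) := by
    intro t
    rw [S.integral_cost_add_sum]
    refine Finset.sum_le_sum fun q _ => ?_
    refine le_sum_stageValue_of_forall_quantizer hv S.transition_nonneg c hβ₀ _
      -- With `q` fixed, the control of `γ` depends on the new symbol only; the comparison action
      -- uses the control map that ignores its quantizer argument and replays this control.
      (S.jointWeight_nonneg π₀ γ t q) (fun m => γ.control t (Fin.snoc q m)) _ fun Q => ?_
    rw [S.sum_jointWeight]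
    exact hbellman _ (S.stateWeight_nonneg π₀ γ t q)
      (Q, fun p => γ.control t (Fin.snoc q p.2))
  have hN : ∀ N, v (fun x => (π₀ : Measure X).real {x})
      ≤ S.finiteCost c β π₀ γ N + β ^ N * ∑ q, v (S.stateWeight π₀ γ N q) := by
    intro N
    rw [S.finiteCost_eq]
    induction N with
    | zero => rw [S.sum_value_zero, Finset.sum_range_zero, pow_zero, one_mul, zero_add]
    | succ N ih =>
      rw [Finset.sum_range_succ]
      have := mul_le_mul_of_nonneg_left (hstep N) (pow_nonneg hβ₀ N)
      rw [pow_succ]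
      linarith
  have hlim := (S.tendsto_finiteCost c hβ₀ hβ₁ hc π₀ γ).add
    (S.tendsto_pow_mul_sum_value π₀ γ hvL hβ₀ hβ₁)
  rw [add_zero] at hlim
  exact ge_of_tendsto' hlim hN

/-! ### Policies with controlled-predictor structure. -/

section ControlledPredictor

variable {S : Plant X U W} {π₀ : ProbabilityMeasure X} {γ : Policy X M U}
  {g : ℕ → ProbabilityMeasure X → Quantizer X M × ControlMap X M U}

/-- The predictor is the normalization of the weights `P(q_{[0,t-1]} = q, x_t = ·)`. -/
theorem Plant.stateWeight_eq_smul_predictor (S : Plant X U W) (π₀ : ProbabilityMeasure X)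
    (γ : Policy X M U) (t : ℕ) (q : Fin t → M) :
    S.stateWeight π₀ γ t q = (S.prob π₀).real {ω | S.pastSymbols γ t ω = q} •
      fun x => (S.predictor π₀ γ t q : Measure X).real {x} := by
  ext x
  have hm : MeasurableSet {ω | S.pastSymbols γ t ω = q} :=
    S.measurableSet_joint γ t {p | p.1 = q}
  rw [Pi.smul_apply, smul_eq_mul]
  -- On null realizations both sides vanish, so the default value π₀ of the predictor is harmless.
  by_cases hq : S.prob π₀ {ω | S.pastSymbols γ t ω = q} = 0
  · rw [measureReal_def, hq, ENNReal.toReal_zero, zero_mul, Plant.stateWeight, measureReal_def,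
      measure_mono_null (fun ω hω => hω.1) hq, ENNReal.toReal_zero]
  · rw [S.coe_predictor_of_ne_zero π₀ γ t q hq,
      map_measureReal_apply (S.measurable_state γ t) (measurableSet_singleton x), measureReal_def, measureReal_def, cond_apply hm, ← ENNReal.toReal_mul, ← mul_assoc,
      ENNReal.mul_inv_cancel hq (measure_ne_top _ _), one_mul]
    rfl

theorem Plant.HasControlledPredictorStructure.control_eq
    (h : S.HasControlledPredictorStructure π₀ γ g) (t : ℕ) (q : Fin t → M) (m : M) :
    γ.control t (Fin.snoc q m) = (g t (S.predictor π₀ γ t q)).2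
      ((g t (S.predictor π₀ γ t q)).1, m) := by
  rw [Policy.control, h.2, Fin.init_snoc, Fin.snoc_last]

/-- Given the past symbols, q_t is a deterministic function of x_t; this is why the mixing
inequality of the lower bound becomes an equality. -/
theorem Plant.HasControlledPredictorStructure.jointWeight_eq
    (h : S.HasControlledPredictorStructure π₀ γ g) (t : ℕ) (q : Fin t → M) (m : M) :
    S.jointWeight π₀ γ t q m
      = cell (S.stateWeight π₀ γ t q) (g t (S.predictor π₀ γ t q)).1 m := by
  have hsym : ∀ ω, S.symbol γ t ω
      = (g t (S.predictor π₀ γ t (S.pastSymbols γ t ω))).1 (S.state γ t ω) := fun ω => h.1 _ _ _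
  ext x
  rw [cell]
  split_ifs with hx
  · rw [Plant.jointWeight, Plant.stateWeight]
    congr 1
    ext ω
    simp only [Set.mem_ofPred_eq]
    constructor
    · exact fun ⟨h1, _, h3⟩ => ⟨h1, h3⟩
    · rintro ⟨h1, h3⟩
      exact ⟨h1, by rw [hsym, h1, h3, hx], h3⟩
  · have : {ω | S.pastSymbols γ t ω = q ∧ S.symbol γ t ω = m ∧ S.state γ t ω = x} = ∅ := by
      ext ω
      simp only [Set.mem_ofPred_eq, Set.mem_empty_iff_false, iff_false]
      rintro ⟨h1, h2, h3⟩
      rw [hsym, h1, h3] at h2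
      exact hx h2
    rw [Plant.jointWeight, this, measureReal_empty]

/-- A controlled-predictor policy that selects minimizers in the Bellman equation attains its
solution. -/
theorem Plant.HasControlledPredictorStructure.discountedCost_eq
    (h : S.HasControlledPredictorStructure π₀ γ g) {c : X → U → ℝ} {β B L : ℝ}
    (hβ₀ : 0 ≤ β) (hβ₁ : β < 1) (hc : ∀ x u, |c x u| ≤ B) {v : (X → ℝ) → ℝ}
    (hv : IsSuperlinear v) (hvL : ∀ μ, 0 ≤ μ → |v μ| ≤ L * ∑ x, μ x)
    (hg : ∀ t (π : ProbabilityMeasure X), v (fun x => (π : Measure X).real {x})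
      = actionValue c S.transition β v (fun x => (π : Measure X).real {x}) (g t π)) :
    S.discountedCost c β π₀ γ = v (fun x => (π₀ : Measure X).real {x}) := by
  have hstep : ∀ t, ∑ q, v (S.stateWeight π₀ γ t q)
      = ∫ ω, c (S.state γ t ω) (S.action γ t ω) ∂(S.prob π₀)
        + β * ∑ q, v (S.stateWeight π₀ γ (t + 1) q) := by
    intro t
    rw [S.integral_cost_add_sum]
    refine Finset.sum_congr rfl fun q _ => ?_
    have hπ : (0 : X → ℝ) ≤ fun x => (S.predictor π₀ γ t q : Measure X).real {x} :=
      fun x => measureReal_nonneg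
    have hact : v (S.stateWeight π₀ γ t q)
        = actionValue c S.transition β v (S.stateWeight π₀ γ t q)
          (g t (S.predictor π₀ γ t q)) := by
      -- Homogeneity carries optimality of `g` from the normalized predictor to the weights, null
      -- realizations included.
      rw [S.stateWeight_eq_smul_predictor, hv.map_smul measureReal_nonneg hπ, hg t]
      exact ((hv.actionValue S.transition_nonneg c hβ₀ _).map_smul measureReal_nonneg hπ).symm
    rw [hact, actionValue]
    simp only [h.jointWeight_eq, h.control_eq]
  have hN : ∀ N, v (fun x => (π₀ : Measure X).real {x})
      = S.finiteCost c β π₀ γ N + β ^ N * ∑ q, v (S.stateWeight π₀ γ N q) := by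
    intro N
    rw [S.finiteCost_eq]
    induction N with
    | zero => rw [S.sum_value_zero, Finset.sum_range_zero, pow_zero, one_mul, zero_add]
    | succ N ih =>
      rw [Finset.sum_range_succ, ih, hstep N]
      ring
  have hlim := (S.tendsto_finiteCost c hβ₀ hβ₁ hc π₀ γ).add
    (S.tendsto_pow_mul_sum_value π₀ γ hvL hβ₀ hβ₁)
  rw [add_zero] at hlim
  exact tendsto_nhds_unique hlim (tendsto_const_nhds.congr hN)

theorem Plant.HasControlledPredictorStructure.integral_cost_eq
    (h : S.HasControlledPredictorStructure π₀ γ g) (c : X → U → ℝ) (t : ℕ) :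
    ∫ ω, c (S.state γ t ω) (S.action γ t ω) ∂(S.prob π₀)
      = ∫ ω, reducedCost c (S.predictor π₀ γ t (S.pastSymbols γ t ω))
          (g t (S.predictor π₀ γ t (S.pastSymbols γ t ω))) ∂(S.prob π₀) := by
  classical
  rw [S.integral_cost, integral_comp_of_finite (S.prob π₀) (S.pastSymbols γ t)
    (fun q => S.measurableSet_joint γ t {p | p.1 = q})
    (fun q => reducedCost c (S.predictor π₀ γ t q) (g t (S.predictor π₀ γ t q)))]
  refine Finset.sum_congr rfl fun q _ => ?_
  rw [Finset.sum_comm, reducedCost, Finset.mul_sum]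
  refine Finset.sum_congr rfl fun x _ => ?_
  simp only [h.jointWeight_eq, h.control_eq, cell, ite_mul, zero_mul]
  rw [Finset.sum_ite_eq, if_pos (Finset.mem_univ _), S.stateWeight_eq_smul_predictor,
    Pi.smul_apply, smul_eq_mul, mul_assoc]

theorem Plant.HasControlledPredictorStructure.finiteReducedCost_eq
    (h : S.HasControlledPredictorStructure π₀ γ g) (c : X → U → ℝ) (β : ℝ) (N : ℕ) :
    S.finiteReducedCost c β π₀ γ g N = S.finiteCost c β π₀ γ N := by
  rw [S.finiteCost_eq, Plant.finiteReducedCost, integral_finsetSum]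
  · simp only [integral_const_mul, h.integral_cost_eq]
  · intro k _
    exact (integrable_comp_of_finite (S.prob π₀) (S.pastSymbols γ k)
      (fun q => S.measurableSet_joint γ k {p | p.1 = q})
      (fun q => reducedCost c (S.predictor π₀ γ k q) (g k (S.predictor π₀ γ k q)))).const_mul _

end ControlledPredictor

end Weights

/-! ### Existence of the policy generated by `g`. -/

section Existence

variable {X M U W : Type*} [MeasurableSpace X] [MeasurableSpace W] [Finite X]
  [DiscreteMeasurableSpace X] [Finite M] [Finite U]

/-- Causality of the predictor, which resolves the circularity of a policy defined through its own
predictors. -/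
theorem Plant.predictor_congr_policy (S : Plant X U W) (π₀ : ProbabilityMeasure X)
    (γ γ' : Policy X M U) (t : ℕ) (he : ∀ s < t, γ.enc s = γ'.enc s)
    (hc : ∀ s < t, γ.ctrl s = γ'.ctrl s) :
    S.predictor π₀ γ t = S.predictor π₀ γ' t := by
  have hh : ∀ ω, S.hist γ ω t = S.hist γ' ω t := fun ω => S.hist_congr_policy γ γ' t ω he hc
  have hp : S.pastSymbols γ t = S.pastSymbols γ' t := by
    ext1 ω
    rw [Plant.pastSymbols, Plant.pastSymbols, hh]
  have hs : S.state γ t = S.state γ' t := by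
    ext1 ω
    rw [Plant.state, Plant.state, hh]
  ext1 q
  by_cases hq : S.prob π₀ {ω | S.pastSymbols γ t ω = q} = 0
  · rw [S.predictor_of_eq_zero π₀ γ t q hq, S.predictor_of_eq_zero π₀ γ' t q (hp ▸ hq)]
  · apply Subtype.ext
    change (S.predictor π₀ γ t q : Measure X) = (S.predictor π₀ γ' t q : Measure X)
    rw [S.coe_predictor_of_ne_zero π₀ γ t q hq, S.coe_predictor_of_ne_zero π₀ γ' t q (hp ▸ hq),
      hp, hs]

/-- The policy that applies `g` to the predictors under the policy `γ`. -/
def Plant.predictorPolicy (S : Plant X U W) (π₀ : ProbabilityMeasure X)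
    (g : ℕ → ProbabilityMeasure X → Quantizer X M × ControlMap X M U) (γ : Policy X M U) :
    Policy X M U where
  enc t x q := (g t (S.predictor π₀ γ t q)).1 (x (Fin.last t))
  ctrl t q _ := (g t (S.predictor π₀ γ t (Fin.init q))).2
    ((g t (S.predictor π₀ γ t (Fin.init q))).1, q (Fin.last t))

/-- Every sequence of maps `g t` defines a policy with controlled-predictor structure. -/
theorem Plant.exists_hasControlledPredictorStructure [Nonempty M] [Nonempty U]
    (S : Plant X U W) (π₀ : ProbabilityMeasure X)
    (g : ℕ → ProbabilityMeasure X → Quantizer X M × ControlMap X M U) :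
    ∃ γ : Policy X M U, S.HasControlledPredictorStructure π₀ γ g := by
  -- The policy sought is a fixed point of `Φ`. By causality, the n-th iterate from any start is
  -- final at times below n.
  let Φ := S.predictorPolicy π₀ g
  let γ₀ : Policy X M U := ⟨fun _ _ _ => Classical.arbitrary M, fun _ _ _ => Classical.arbitrary U⟩
  let γs : ℕ → Policy X M U := fun n => Φ^[n] γ₀
  have hsucc : ∀ n, γs (n + 1) = Φ (γs n) := fun n => Function.iterate_succ_apply' Φ n γ₀
  have hΦ : ∀ (γ γ' : Policy X M U) (t : ℕ), (∀ s < t, γ.enc s = γ'.enc s) →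
      (∀ s < t, γ.ctrl s = γ'.ctrl s) →
      (Φ γ).enc t = (Φ γ').enc t ∧ (Φ γ).ctrl t = (Φ γ').ctrl t := by
    intro γ γ' t he hc
    simp only [Φ, Plant.predictorPolicy, S.predictor_congr_policy π₀ γ γ' t he hc, and_self]
  have hstable : ∀ n, ∀ s < n,
      (γs (n + 1)).enc s = (γs n).enc s ∧ (γs (n + 1)).ctrl s = (γs n).ctrl s := by
    intro n
    induction n with
    | zero => intro s hs; exact absurd hs (Nat.not_lt_zero s)
    | succ n ih =>
      intro s hs
      have hsn : ∀ r < s, r < n := fun r hr => hr.trans_le (Nat.lt_succ_iff.1 hs)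
      have h := hΦ (γs (n + 1)) (γs n) s (fun r hr => (ih r (hsn r hr)).1)
        fun r hr => (ih r (hsn r hr)).2
      rwa [← hsucc, ← hsucc] at h
  have hle : ∀ s n, s < n →
      (γs n).enc s = (γs (s + 1)).enc s ∧ (γs n).ctrl s = (γs (s + 1)).ctrl s := by
    intro s n hsn
    induction n, hsn using Nat.le_induction with
    | base => exact ⟨rfl, rfl⟩
    | succ n hn ih =>
      exact ⟨(hstable n s hn).1.trans ih.1, (hstable n s hn).2.trans ih.2⟩
  -- The diagonal: the rule at time `t` is read off at iterate `t + 1`, the first at which it is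
  -- final.
  let γ : Policy X M U := ⟨fun t => (γs (t + 1)).enc t, fun t => (γs (t + 1)).ctrl t⟩
  have hpred : ∀ t, S.predictor π₀ γ t = S.predictor π₀ (γs t) t := fun t =>
    S.predictor_congr_policy π₀ γ (γs t) t (fun s hs => (hle s t hs).1.symm)
      fun s hs => (hle s t hs).2.symm
  refine ⟨γ, fun t x q => ?_, fun t q u => ?_⟩
  · rw [hpred]
    change (γs (t + 1)).enc t x q = _
    rw [hsucc]
    rfl
  · rw [hpred]
    change (γs (t + 1)).ctrl t q u = _
    rw [hsucc]
    rfl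

end Existence

/-! ### Measurable selection of minimizers. -/

section Selector

/-- A measurable choice of minimizers of finitely many measurable functions. -/
theorem exists_measurable_argmin {α ι : Type*} [MeasurableSpace α] [Finite ι] [Nonempty ι]
    (F : ι → α → ℝ) (hF : ∀ i, Measurable (F i)) :
    ∃ g : α → ι, Measurable[inferInstance, ⊤] g ∧ ∀ a i, F (g a) a ≤ F i a := by
  classical
  -- Ties are broken by taking the first minimizer in an enumeration of `ι`, which keeps the choice
  -- measurable.
  obtain ⟨e, he⟩ := exists_surjective_nat ι
  have hex : ∀ a, ∃ k, ∀ i, F (e k) a ≤ F i a := fun a => by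
    obtain ⟨i, hi⟩ := Finite.exists_min fun i => F i a
    obtain ⟨k, rfl⟩ := he i
    exact ⟨k, hi⟩
  have hfind : Measurable fun a => Nat.find (hex a) := by
    refine measurable_find hex fun k => ?_
    simp only [Set.ofPred_forall]
    exact MeasurableSet.iInter fun i => measurableSet_le (hF _) (hF i)
  refine ⟨fun a => e (Nat.find (hex a)), ?_, fun a i => Nat.find_spec (hex a) i⟩
  exact fun s _ => hfind (MeasurableSet.of_discrete (s := e ⁻¹' s))

theorem measurable_actionValue {X M U : Type*} [Fintype X] [Fintype M] [MeasurableSpace X]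
    [DiscreteMeasurableSpace X] (c : X → U → ℝ) {K : X → U → X → ℝ}
    (hK : ∀ x u x', 0 ≤ K x u x') (β : ℝ) {v : (X → ℝ) → ℝ}
    (hv : Measurable fun μ : {μ : X → ℝ // 0 ≤ μ} => v μ)
    (a : Quantizer X M × ControlMap X M U) :
    Measurable fun π : ProbabilityMeasure X =>
      actionValue c K β v (fun x => (π : Measure X).real {x}) a := by
  have hcell : ∀ m x, Measurable fun π : ProbabilityMeasure X =>
      cell (fun x => (π : Measure X).real {x}) a.1 m x := by
    intro m x
    unfold cell
    split_ifs
    · exact ((Measure.measurable_coe (measurableSet_singleton x)).comp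
        measurable_subtype_coe).ennreal_toReal
    · exact measurable_const
  refine Finset.measurable_fun_sum _ fun m _ => Measurable.add ?_ (Measurable.const_mul ?_ _)
  · exact Finset.measurable_fun_sum _ fun x _ => (hcell m x).mul_const _
  -- As `v` is measurable only on the cone, `push` is viewed as a map into the subtype.
  · have hpush : Measurable fun π : ProbabilityMeasure X =>
        (⟨push K (cell (fun x => (π : Measure X).real {x}) a.1 m) (a.2 (a.1, m)),
          push_nonneg hK (cell_nonneg (fun _ => measureReal_nonneg) _ _) _⟩ :
            {μ : X → ℝ // 0 ≤ μ}) :=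
      (measurable_pi_lambda _ fun x' => Finset.measurable_fun_sum _ fun x _ =>
        (hcell m x).mul_const _).subtype_mk
    exact hv.comp hpush

end Selector

end CodingControl

end

/-! ### The optimality theorem. -/

theorem mainTheorem1 {X M U W : Type*} [Fintype X] [MeasurableSpace X]
    [DiscreteMeasurableSpace X] [Finite M] [Nonempty M] [Finite U] [Nonempty U]
    [MeasurableSpace W] (S : CodingControl.Plant X U W) (c : X → U → ℝ)
    (β : ℝ) (hβ₀ : 0 < β) (hβ₁ : β < 1) :
    ∃ g : ProbabilityMeasure X →
        CodingControl.Quantizer X M × CodingControl.ControlMap X M U,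
      -- the finite set of pairs `(Q, η)` carries the discrete σ-algebra
      Measurable[inferInstance, ⊤] g ∧
      ∀ π₀ : ProbabilityMeasure X,
        -- the limit defining the discounted cost exists for every admissible policy
        (∀ γ' : CodingControl.Policy X M U,
          Tendsto (S.finiteCost c β π₀ γ') atTop (𝓝 (S.discountedCost c β π₀ γ'))) ∧
        ∃ γ : CodingControl.Policy X M U,
          S.HasControlledPredictorStructure π₀ γ (fun _ => g) ∧
          IsLeast (Set.range fun γ' : CodingControl.Policy X M U =>
            S.discountedCost c β π₀ γ') (S.discountedCost c β π₀ γ) ∧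
          Tendsto (S.finiteReducedCost c β π₀ γ (fun _ => g)) atTop
            (𝓝 (S.discountedCost c β π₀ γ)) := by
  classical
  obtain ⟨_⟩ := nonempty_fintype M
  obtain ⟨_⟩ := nonempty_fintype U
  obtain ⟨B, hB₀, hc⟩ : ∃ B : ℝ, 0 ≤ B ∧ ∀ x u, |c x u| ≤ B := by
    refine ⟨∑ p : X × U, |c p.1 p.2|, Finset.sum_nonneg fun _ _ => abs_nonneg _, fun x u => ?_⟩
    exact Finset.single_le_sum (f := fun p : X × U => |c p.1 p.2|) (fun _ _ => abs_nonneg _)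
      (Finset.mem_univ (x, u))
  have hβ : 0 < 1 - β := sub_pos.2 hβ₁
  -- The constant L = B / (1 - β) is the discounted sum of the cost bound, the value for which the
  -- growth bound reproduces itself.
  have hL : B + β * (B / (1 - β)) = B / (1 - β) := by
    field_simp
    ring
  obtain ⟨v, hv, hvL, hfix, hmeas⟩ := CodingControl.exists_bellman_fixedPoint (M := M) hc
    S.transition_nonneg S.sum_transition hβ₀.le (div_nonneg hB₀ hβ.le) hL
  obtain ⟨g, hg, hmin⟩ := CodingControl.exists_measurable_argmin
    (fun (a : CodingControl.Quantizer X M × CodingControl.ControlMap X M U)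
      (π : ProbabilityMeasure X) => CodingControl.actionValue c S.transition β v
        (fun x => (π : Measure X).real {x}) a)
    (CodingControl.measurable_actionValue c S.transition_nonneg β hmeas)
  have hle : ∀ μ, 0 ≤ μ → ∀ a : CodingControl.Quantizer X M × CodingControl.ControlMap X M U,
      v μ ≤ CodingControl.actionValue c S.transition β v μ a := fun μ hμ a =>
    (hfix μ hμ).trans_le (CodingControl.bellman_le c S.transition β v μ a)
  have hopt : ∀ (_ : ℕ) (π : ProbabilityMeasure X), v (fun x => (π : Measure X).real {x})
      = CodingControl.actionValue c S.transition β v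
        (fun x => (π : Measure X).real {x}) (g π) := by
    intro _ π
    have hπ : (0 : X → ℝ) ≤ fun x => (π : Measure X).real {x} := fun x => measureReal_nonneg
    refine le_antisymm (hle _ hπ _) ?_
    rw [hfix _ hπ, CodingControl.le_bellman_iff]
    exact hmin π
  refine ⟨g, hg, fun π₀ => ⟨S.tendsto_finiteCost c hβ₀.le hβ₁ hc π₀, ?_⟩⟩
  obtain ⟨γ, hγ⟩ := S.exists_hasControlledPredictorStructure π₀ (fun _ => g)
  have hcost := hγ.discountedCost_eq hβ₀.le hβ₁ hc hv hvL hopt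
  refine ⟨γ, hγ, ⟨⟨γ, rfl⟩, ?_⟩, ?_⟩
  · rintro _ ⟨γ', rfl⟩
    rw [hcost]
    exact S.value_le_discountedCost hβ₀.le hβ₁ hc hv hvL hle π₀ γ'
  · refine (S.tendsto_finiteCost c hβ₀.le hβ₁ hc π₀ γ).congr fun N => ?_
    exact (hγ.finiteReducedCost_eq c β N).symm
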